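/- Let $m,n\ge 1$ be integers, let $\mathbb M_n$ be the space of $n\times n$ complex matrices, and for $Z\in\mathbb M_n$ let $|Z|=(Z^*Z)^{1/2}$ denote the positive semidefinite square root of $Z^*Z$. A norm $\|\cdot\|$ on $\mathbb M_n$ is unitarily invariant if $\|UZV\|=\|Z\|$ for all $Z\in\mathbb M_n$ and all unitary $U,V\in\mathbb M_n$. Then for every unitarily invariant norm $\|\cdot\|$ on $\mathbb M_n$ and all $A_1,\dots,A_m\in\mathbb M_n$, $$\Bigl\|\sum_{k=1}^m A_k\Bigr\|\ \le\ \sqrt{\min\{m,n\}}\,\Bigl\|\sum_{k=1}^m |A_k|\Bigr\|.$$ Moreover, the constant $\sqrt{\min\{m,n\}}$ is sharp: for the operator norm $\|\cdot\|_\infty$ (the largest singular value) there are $A_1,\dots,A_m\in\mathbb M_n$ with $\sum_{k=1}^m|A_k|\ne 0$ and $$\Bigl\|\sum_{k=1}^m A_k\Bigr\|_\infty=\sqrt{\min\{m,n\}}\,\Bigl\|\sum_{k=1}^m |A_k|\Bigr\|_\infty,$$ and, for the given $m$ and $n$, every real $c$ for which $\|\sum_{k=1}^m A_k\|\le c\,\|\sum_{k=1}^m|A_k|\|$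 holds for all unitarily invariant norms on $\mathbb M_n$ and all $A_1,\dots,A_m\in\mathbb M_n$ satisfies $c\ge\sqrt{\min\{m,n\}}$. -/

import Mathlib

open scoped Matrix MatrixOrder ComplexOrder

noncomputable section

/-- The usual modulus `|Z| = (Zᴴ Z)^{1/2}` of a square complex matrix, where the square root is
the positive semidefinite one. -/
def matrixModulus {n : ℕ} (Z : Matrix (Fin n) (Fin n) ℂ) : Matrix (Fin n) (Fin n) ℂ :=
  CFC.sqrt (Zᴴ * Z)

/-- A seminorm `N` on the `n × n` complex matrices is a unitarily invariant norm if it is definite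
and `N (U Z V) = N Z` for all unitary matrices `U`, `V`. -/
structure IsUnitarilyInvariantNorm {n : ℕ} (N : Seminorm ℂ (Matrix (Fin n) (Fin n) ℂ)) : Prop where
  eq_zero_of_map_eq_zero : ∀ Z, N Z = 0 → Z = 0
  map_unitary_mul_mul : ∀ U ∈ Matrix.unitaryGroup (Fin n) ℂ,
    ∀ V ∈ Matrix.unitaryGroup (Fin n) ℂ, ∀ Z, N (U * Z * V) = N Z

/-- The operator norm (largest singular value) of a complex matrix acting on Euclidean space. -/
def matrixOperatorNorm {n : ℕ} (Z : Matrix (Fin n) (Fin n) ℂ) : ℝ :=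
  ‖Matrix.toEuclideanCLM (n := Fin n) (𝕜 := ℂ) Z‖

end

/-! Write `A k = U k * P k` with `P k` the modulus, and `∑ A k = X = V * |X|`, so `|X| = ∑ W k * P
k` with `W k = V* U k` unitary. Let `S = ∑ P k`, `T = ∑ W k * P k * (W k)*` and `c = √min(m,n)`.
Positivity of `(sW - 1) P (sW - 1)*` with `s = c⁻¹`, summed over `k`, gives `2|X| ≤ c⁻¹ T + c S`. A
unitarily invariant norm is monotone on positive matrices (`map_le_map_of_le`), so everything rests
on `N T ≤ c² N S` (`map_sum_conj_le`): the factor `m` comes from the triangle inequality, the factor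
`n` from equality of traces. For sharpness take matrix units in one row: their moduli sum to a
projection, while they themselves sum to a row of `min(m,n)` ones. -/

section UnitarilyInvariantNorms

open scoped Matrix.Norms.L2Operator

/-! ### Polar decomposition -/

section Modulus

variable {n : ℕ} (Z : Matrix (Fin n) (Fin n) ℂ)

theorem matrixModulus_nonneg : 0 ≤ matrixModulus Z := CFC.sqrt_nonneg _

theorem matrixModulus_mul_self : matrixModulus Z * matrixModulus Z = Zᴴ * Z :=
  CFC.sqrt_mul_sqrt_self _ (star_mul_self_nonneg Z)

theorem conjTranspose_matrixModulus : (matrixModulus Z)ᴴ = matrixModulus Z :=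
  (IsSelfAdjoint.of_nonneg (matrixModulus_nonneg Z)).star_eq

theorem norm_matrixModulus : ‖matrixModulus Z‖ = ‖Z‖ := by
  have h := Matrix.l2_opNorm_conjTranspose_mul_self (matrixModulus Z)
  rw [conjTranspose_matrixModulus, matrixModulus_mul_self,
    Matrix.l2_opNorm_conjTranspose_mul_self] at h
  exact ((mul_self_inj (norm_nonneg _) (norm_nonneg _)).1 h).symm

theorem norm_toEuclideanCLM_matrixModulus_apply (x : EuclideanSpace ℂ (Fin n)) :
    ‖Matrix.toEuclideanCLM (n := Fin n) (𝕜 := ℂ) (matrixModulus Z) x‖ =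
      ‖Matrix.toEuclideanCLM (n := Fin n) (𝕜 := ℂ) Z x‖ := by
  have key : ∀ B : Matrix (Fin n) (Fin n) ℂ,
      inner ℂ x (Matrix.toEuclideanCLM (n := Fin n) (𝕜 := ℂ) (Bᴴ * B) x) =
        ((‖Matrix.toEuclideanCLM (n := Fin n) (𝕜 := ℂ) B x‖ ^ 2 : ℝ) : ℂ) := by
    intro B
    rw [map_mul, ← Matrix.star_eq_conjTranspose, map_star, ContinuousLinearMap.star_eq_adjoint,
      mul_apply_eq_comp, ContinuousLinearMap.adjoint_inner_right,
      inner_self_eq_norm_sq_to_K]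
    push_cast
    rfl
  have h := key (matrixModulus Z)
  rw [conjTranspose_matrixModulus, matrixModulus_mul_self, key Z] at h
  have h' := Complex.ofReal_injective h
  exact ((sq_eq_sq₀ (norm_nonneg _) (norm_nonneg _)).1 h').symm

/-- Polar decomposition of a square matrix, with a unitary factor. -/
theorem exists_unitary_mul_matrixModulus :
    ∃ U ∈ Matrix.unitaryGroup (Fin n) ℂ, Z = U * matrixModulus Z := by
  set T := Matrix.toEuclideanCLM (n := Fin n) (𝕜 := ℂ)
  let p : EuclideanSpace ℂ (Fin n) →ₗ[ℂ] EuclideanSpace ℂ (Fin n) := (T (matrixModulus Z)).toLinearMap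
  let z : EuclideanSpace ℂ (Fin n) →ₗ[ℂ] EuclideanSpace ℂ (Fin n) := (T Z).toLinearMap
  have hpz : ∀ x, ‖p x‖ = ‖z x‖ := norm_toEuclideanCLM_matrixModulus_apply Z
  have hker : p.ker ≤ z.ker := by
    intro x hx
    rw [LinearMap.mem_ker] at hx ⊢
    rw [← norm_eq_zero, ← hpz, hx, norm_zero]
  -- The map `p x ↦ z x` is well defined and isometric on the range of `p`, since `‖p x‖ = ‖z x‖`.
  let g : p.range →ₗ[ℂ] EuclideanSpace ℂ (Fin n) :=
    (p.ker.liftQ z hker).comp p.quotKerEquivRange.symm.toLinearMap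
  have hg : ∀ x, g ⟨p x, LinearMap.mem_range_self p x⟩ = z x := by
    intro x
    have : p.quotKerEquivRange.symm ⟨p x, LinearMap.mem_range_self p x⟩ = p.ker.mkQ x := by
      rw [LinearEquiv.symm_apply_eq]
      rfl
    simp only [g, LinearMap.comp_apply, LinearEquiv.coe_coe, this]
    exact Submodule.liftQ_apply _ _ _
  let gi : p.range →ₗᵢ[ℂ] EuclideanSpace ℂ (Fin n) :=
    { g with
      norm_map' := by
        rintro ⟨_, x, rfl⟩
        change ‖g ⟨p x, _⟩‖ = ‖p x‖
        rw [hg, hpz] }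
  -- In finite dimension this partial isometry extends to an isometry of the whole space, which is
  -- unitary.
  let W := gi.extend
  have hW : ∀ x, W (p x) = z x := fun x => by
    rw [← hg x]
    exact gi.extend_apply ⟨p x, LinearMap.mem_range_self p x⟩
  refine ⟨T.symm W.toContinuousLinearMap, ?_, ?_⟩
  · rw [Matrix.mem_unitaryGroup_iff']
    apply EquivLike.injective T
    rw [map_mul, map_star, StarAlgEquiv.apply_symm_apply, map_one, ContinuousLinearMap.star_eq_adjoint]
    exact (ContinuousLinearMap.norm_map_iff_adjoint_comp_self _).1 W.norm_map
  · apply EquivLike.injective T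
    rw [map_mul, StarAlgEquiv.apply_symm_apply]
    ext1 x
    exact (hW x).symm

end Modulus

namespace IsUnitarilyInvariantNorm

variable {n : ℕ} {N : Seminorm ℂ (Matrix (Fin n) (Fin n) ℂ)}

theorem map_unitary_mul (hN : IsUnitarilyInvariantNorm N)
    {U : Matrix (Fin n) (Fin n) ℂ} (hU : U ∈ Matrix.unitaryGroup (Fin n) ℂ)
    (Z : Matrix (Fin n) (Fin n) ℂ) : N (U * Z) = N Z := by
  simpa using hN.map_unitary_mul_mul U hU 1 (one_mem _) Z

theorem map_mul_unitary (hN : IsUnitarilyInvariantNorm N)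
    {U : Matrix (Fin n) (Fin n) ℂ} (hU : U ∈ Matrix.unitaryGroup (Fin n) ℂ)
    (Z : Matrix (Fin n) (Fin n) ℂ) : N (Z * U) = N Z := by
  simpa using hN.map_unitary_mul_mul 1 (one_mem _) U hU Z

end IsUnitarilyInvariantNorm

/-! ### Contractions and monotonicity -/

theorem norm_single_le_one {n : ℕ} (i j : Fin n) :
    ‖(Matrix.single i j 1 : Matrix (Fin n) (Fin n) ℂ)‖ ≤ 1 := by
  have h := Matrix.l2_opNorm_conjTranspose_mul_self (Matrix.single i j 1 : Matrix (Fin n) (Fin n) ℂ)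
  rw [Matrix.conjTranspose_single, star_one, Matrix.single_mul_single_same, mul_one,
    ← Matrix.diagonal_single, Matrix.l2_opNorm_diagonal, Pi.norm_single, norm_one] at h
  nlinarith [norm_nonneg (Matrix.single i j 1 : Matrix (Fin n) (Fin n) ℂ)]

/-- Take `V = H + i √(1 - H²)`, whose real part is `H`. -/
theorem exists_unitary_add_star {n : ℕ} {H : Matrix (Fin n) (Fin n) ℂ} (hH : Hᴴ = H) (hH1 : ‖H‖ ≤ 1) :
    ∃ V ∈ Matrix.unitaryGroup (Fin n) ℂ, H = (2⁻¹ : ℂ) • (V + star V) := by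
  let V := selfAdjoint.unitarySelfAddISMul ⟨H, hH⟩ hH1
  refine ⟨V, V.2, ?_⟩
  have h := selfAdjoint.star_coe_unitarySelfAddISMul ⟨H, hH⟩ hH1
  have h' := selfAdjoint.unitarySelfAddISMul_coe ⟨H, hH⟩ hH1
  simp only at h
  rw [h, h']
  simp only [add_add_sub_cancel, ← two_smul ℂ H, smul_smul]
  norm_num

namespace IsUnitarilyInvariantNorm

variable {n : ℕ} {N : Seminorm ℂ (Matrix (Fin n) (Fin n) ℂ)}

/-- By polar decomposition, `K` is a unitary times the mean of two unitaries. -/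
theorem map_contraction_mul_le (hN : IsUnitarilyInvariantNorm N) {K : Matrix (Fin n) (Fin n) ℂ}
    (hK : ‖K‖ ≤ 1) (Z : Matrix (Fin n) (Fin n) ℂ) : N (K * Z) ≤ N Z := by
  obtain ⟨U, hU, hUK⟩ := exists_unitary_mul_matrixModulus K
  obtain ⟨V, hV, hVK⟩ := exists_unitary_add_star (conjTranspose_matrixModulus K)
    ((norm_matrixModulus K).trans_le hK)
  rw [hUK, mul_assoc, hN.map_unitary_mul hU, hVK, smul_mul_assoc, map_smul_eq_mul, add_mul]
  have h := map_add_le_add N (V * Z) (star V * Z)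
  rw [hN.map_unitary_mul hV, hN.map_unitary_mul (Unitary.star_mem hV)] at h
  norm_num
  linarith

theorem map_mul_contraction_le (hN : IsUnitarilyInvariantNorm N) {K : Matrix (Fin n) (Fin n) ℂ}
    (hK : ‖K‖ ≤ 1) (Z : Matrix (Fin n) (Fin n) ℂ) : N (Z * K) ≤ N Z := by
  obtain ⟨U, hU, hUK⟩ := exists_unitary_mul_matrixModulus K
  obtain ⟨V, hV, hVK⟩ := exists_unitary_add_star (conjTranspose_matrixModulus K)
    ((norm_matrixModulus K).trans_le hK)
  rw [hUK, ← mul_assoc, hVK, mul_smul_comm, map_smul_eq_mul, mul_add]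
  have h := map_add_le_add N (Z * U * V) (Z * U * star V)
  rw [hN.map_mul_unitary hV, hN.map_mul_unitary (Unitary.star_mem hV), hN.map_mul_unitary hU] at h
  norm_num
  linarith

/-- The matrix `K = P^{1/2} S^{-1/2}` is a contraction because `K* K = S^{-1/2} P S^{-1/2} ≤ 1`, and
`P = K S K*`. -/
theorem map_le_map_of_posDef (hN : IsUnitarilyInvariantNorm N) {P S : Matrix (Fin n) (Fin n) ℂ}
    (hP : 0 ≤ P) (hPS : P ≤ S) (hS : S.PosDef) : N P ≤ N S := by
  set Q := CFC.sqrt S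
  have hQQ : Q * Q = S := CFC.sqrt_mul_sqrt_self S (hP.trans hPS)
  have hQu : IsUnit Q := (CFC.isUnit_sqrt_iff S (hP.trans hPS)).2 hS.isUnit
  have hQdet : IsUnit Q.det := (Matrix.isUnit_iff_isUnit_det Q).1 hQu
  have hQs : Qᴴ = Q := (IsSelfAdjoint.of_nonneg (CFC.sqrt_nonneg S)).star_eq
  set R := Q⁻¹
  have hRs : Rᴴ = R := by rw [Matrix.conjTranspose_nonsing_inv, hQs]
  have hRQ : R * Q = 1 := Matrix.nonsing_inv_mul Q hQdet
  have hQR : Q * R = 1 := Matrix.mul_nonsing_inv Q hQdet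
  set B := CFC.sqrt P
  have hBB : B * B = P := CFC.sqrt_mul_sqrt_self P hP
  have hBs : Bᴴ = B := (IsSelfAdjoint.of_nonneg (CFC.sqrt_nonneg P)).star_eq
  have hRSR : R * S * R = 1 := by
    rw [← hQQ, ← mul_assoc R, hRQ, one_mul, hQR]
  have hRPR : R * P * R ≤ 1 := by
    rw [← hRSR]
    exact IsSelfAdjoint.conjugate_le_conjugate hPS hRs
  have hK : ‖B * R‖ ≤ 1 := by
    have h := Matrix.l2_opNorm_conjTranspose_mul_self (B * R)
    have e : (B * R)ᴴ * (B * R) = R * P * R := by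
      rw [Matrix.conjTranspose_mul, hRs, hBs, ← hBB]
      simp only [mul_assoc]
    rw [e] at h
    have h1 : ‖R * P * R‖ ≤ 1 :=
      (CStarAlgebra.norm_le_one_iff_of_nonneg _ (IsSelfAdjoint.conjugate_nonneg hP hRs)).2 hRPR
    nlinarith [norm_nonneg (B * R)]
  have e : P = B * R * (S * (B * R)ᴴ) := by
    rw [Matrix.conjTranspose_mul, hRs, hBs, ← hQQ]
    calc P = B * (R * Q) * (Q * R) * B := by rw [hRQ, hQR, mul_one, mul_one, hBB]
      _ = _ := by simp only [mul_assoc]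
  rw [e]
  refine (hN.map_contraction_mul_le hK _).trans (hN.map_mul_contraction_le ?_ _)
  rwa [Matrix.l2_opNorm_conjTranspose]

theorem map_le_map_of_le (hN : IsUnitarilyInvariantNorm N) {P S : Matrix (Fin n) (Fin n) ℂ}
    (hP : 0 ≤ P) (hPS : P ≤ S) : N P ≤ N S := by
  have key : ∀ ε : ℝ, 0 < ε → N P ≤ N S + ε * N 1 := by
    intro ε hε
    have h1 : ((ε : ℂ) • (1 : Matrix (Fin n) (Fin n) ℂ)).PosDef :=
      Matrix.PosDef.one.smul (by exact_mod_cast hε)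
    have hS : (S + (ε : ℂ) • (1 : Matrix (Fin n) (Fin n) ℂ)).PosDef :=
      Matrix.PosDef.posSemidef_add (Matrix.nonneg_iff_posSemidef.1 (hP.trans hPS)) h1
    have hle : P ≤ S + (ε : ℂ) • (1 : Matrix (Fin n) (Fin n) ℂ) :=
      hPS.trans (le_add_of_nonneg_right (Matrix.nonneg_iff_posSemidef.2 h1.posSemidef))
    refine (hN.map_le_map_of_posDef hP hle hS).trans ((map_add_le_add N _ _).trans_eq ?_)
    rw [map_smul_eq_mul, Complex.norm_of_nonneg hε.le]
  refine le_of_forall_pos_le_add fun δ hδ => ?_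
  have h0 : 0 ≤ N 1 := apply_nonneg N 1
  -- The `+ 1` keeps the denominator positive even if `N 1 = 0`, as happens for `n = 0`.
  refine (key (δ / (N 1 + 1)) (by positivity)).trans ?_
  gcongr
  rw [div_mul_eq_mul_div, div_le_iff₀ (by positivity)]
  nlinarith

/-! ### Comparison with the trace -/

theorem map_single_le (hN : IsUnitarilyInvariantNorm N) (i j : Fin n) :
    N (Matrix.single i i 1) ≤ N (Matrix.single j j 1) := by
  have e : (Matrix.single i i 1 : Matrix (Fin n) (Fin n) ℂ) =
      Matrix.single i j 1 * (Matrix.single j j 1 * Matrix.single j i 1) := by simp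
  rw [e]
  exact (hN.map_contraction_mul_le (norm_single_le_one i j) _).trans
    (hN.map_mul_contraction_le (norm_single_le_one j i) _)

theorem map_diagonal_eigenvalues (hN : IsUnitarilyInvariantNorm N)
    {T : Matrix (Fin n) (Fin n) ℂ} (hT : T.IsHermitian) :
    N (Matrix.diagonal fun i => (hT.eigenvalues i : ℂ)) = N T := by
  conv_rhs => rw [hT.spectral_theorem, Unitary.conjStarAlgAut_apply]
  exact (hN.map_unitary_mul_mul _ hT.eigenvectorUnitary.2 _
    (Unitary.star_mem hT.eigenvectorUnitary.2) _).symm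

/-- Triangle inequality on the diagonalization; all diagonal matrix units have the same norm. -/
theorem map_le_trace_mul (hN : IsUnitarilyInvariantNorm N)
    {T : Matrix (Fin n) (Fin n) ℂ} (hT : T.PosSemidef) (j : Fin n) :
    N T ≤ T.trace.re * N (Matrix.single j j 1) := by
  have e : (Matrix.diagonal fun i => (hT.isHermitian.eigenvalues i : ℂ)) =
      ∑ i, (hT.isHermitian.eigenvalues i : ℂ) • Matrix.single i i (1 : ℂ) := by
    rw [← Finset.univ_sum_single (fun i => (hT.isHermitian.eigenvalues i : ℂ))]
    simp only [← Matrix.diagonalAddMonoidHom_apply, map_sum]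
    refine Finset.sum_congr rfl fun i _ => ?_
    rw [Matrix.diagonalAddMonoidHom_apply, Matrix.diagonal_single, Matrix.smul_single, smul_eq_mul,
      mul_one]
  rw [← hN.map_diagonal_eigenvalues hT.isHermitian, e, hT.isHermitian.trace_eq_sum_eigenvalues,
    Complex.re_sum, Finset.sum_mul]
  refine (Finset.le_sum_of_subadditive N (map_zero N).le (map_add_le_add N) _ _).trans
    (Finset.sum_le_sum fun i _ => ?_)
  rw [map_smul_eq_mul, Complex.norm_of_nonneg (hT.eigenvalues_nonneg i)]
  exact mul_le_mul_of_nonneg_left (hN.map_single_le i j) (hT.eigenvalues_nonneg i)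

/-- Each of the `n` eigenvalues, placed alone on the diagonal, is dominated by the full diagonal
form of `S`. -/
theorem trace_mul_le (hN : IsUnitarilyInvariantNorm N)
    {S : Matrix (Fin n) (Fin n) ℂ} (hS : S.PosSemidef) (j : Fin n) :
    S.trace.re * N (Matrix.single j j 1) ≤ n * N S := by
  have key : ∀ i, hS.isHermitian.eigenvalues i * N (Matrix.single j j 1) ≤ N S := by
    intro i
    have h0 := hS.eigenvalues_nonneg i
    rw [← hN.map_diagonal_eigenvalues hS.isHermitian]
    calc hS.isHermitian.eigenvalues i * N (Matrix.single j j 1)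
        ≤ hS.isHermitian.eigenvalues i * N (Matrix.single i i 1) :=
          mul_le_mul_of_nonneg_left (hN.map_single_le j i) h0
      _ = N (Matrix.diagonal (Pi.single i (hS.isHermitian.eigenvalues i : ℂ))) := by
          have e : (Matrix.single i i (hS.isHermitian.eigenvalues i : ℂ) :
              Matrix (Fin n) (Fin n) ℂ) =
              (hS.isHermitian.eigenvalues i : ℂ) • Matrix.single i i (1 : ℂ) := by
            rw [Matrix.smul_single, smul_eq_mul, mul_one]
          rw [Matrix.diagonal_single, e, map_smul_eq_mul, Complex.norm_of_nonneg h0]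
      _ ≤ _ := by
          refine hN.map_le_map_of_le ?_ ?_
          · rw [Matrix.nonneg_iff_posSemidef, Matrix.posSemidef_diagonal_iff]
            intro k
            rcases eq_or_ne k i with rfl | h
            · simpa using h0
            · simp [h]
          · rw [Matrix.le_iff, Matrix.diagonal_sub, Matrix.posSemidef_diagonal_iff]
            intro k
            rcases eq_or_ne k i with rfl | h
            · simp
            · simpa [h] using hS.eigenvalues_nonneg k
  rw [hS.isHermitian.trace_eq_sum_eigenvalues, Complex.re_sum, Finset.sum_mul]
  refine (Finset.sum_le_sum fun i _ => key i).trans_eq ?_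
  simp

end IsUnitarilyInvariantNorm

/-! ### The inequality -/

namespace IsUnitarilyInvariantNorm

variable {m n : ℕ} {N : Seminorm ℂ (Matrix (Fin n) (Fin n) ℂ)}

theorem map_sum_conj_le_card_mul (hN : IsUnitarilyInvariantNorm N)
    {P W : Fin m → Matrix (Fin n) (Fin n) ℂ} (hP : ∀ k, 0 ≤ P k)
    (hW : ∀ k, W k ∈ Matrix.unitaryGroup (Fin n) ℂ) :
    N (∑ k, W k * P k * star (W k)) ≤ m * N (∑ k, P k) := by
  calc N (∑ k, W k * P k * star (W k)) ≤ ∑ k, N (W k * P k * star (W k)) :=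
        Finset.le_sum_of_subadditive N (map_zero N).le (map_add_le_add N) _ _
    _ ≤ ∑ _k : Fin m, N (∑ k, P k) := Finset.sum_le_sum fun k _ => by
        rw [hN.map_unitary_mul_mul _ (hW k) _ (Unitary.star_mem (hW k))]
        exact hN.map_le_map_of_le (hP k)
          (Finset.single_le_sum (fun i _ => hP i) (Finset.mem_univ k))
    _ = m * N (∑ k, P k) := by simp

/-- Conjugation preserves each trace, so both sums have the same trace, which bounds one norm above
and the other below. -/
theorem map_sum_conj_le_dim_mul (hN : IsUnitarilyInvariantNorm N)
    {P W : Fin m → Matrix (Fin n) (Fin n) ℂ} (hP : ∀ k, 0 ≤ P k)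
    (hW : ∀ k, W k ∈ Matrix.unitaryGroup (Fin n) ℂ) (hn : 1 ≤ n) :
    N (∑ k, W k * P k * star (W k)) ≤ n * N (∑ k, P k) := by
  have hT : 0 ≤ ∑ k, W k * P k * star (W k) :=
    Finset.sum_nonneg fun k _ => star_right_conjugate_nonneg (hP k) (W k)
  have htr : (∑ k, W k * P k * star (W k)).trace = (∑ k, P k).trace := by
    simp only [Matrix.trace_sum]
    refine Finset.sum_congr rfl fun k _ => ?_
    rw [Matrix.trace_mul_cycle, Matrix.mem_unitaryGroup_iff'.1 (hW k), one_mul]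
  refine (hN.map_le_trace_mul (Matrix.nonneg_iff_posSemidef.1 hT) ⟨0, hn⟩).trans ?_
  rw [htr]
  exact hN.trace_mul_le (Matrix.nonneg_iff_posSemidef.1 (Finset.sum_nonneg fun k _ => hP k)) _

theorem map_sum_conj_le (hN : IsUnitarilyInvariantNorm N)
    {P W : Fin m → Matrix (Fin n) (Fin n) ℂ} (hP : ∀ k, 0 ≤ P k)
    (hW : ∀ k, W k ∈ Matrix.unitaryGroup (Fin n) ℂ) (hn : 1 ≤ n) :
    N (∑ k, W k * P k * star (W k)) ≤ (min m n : ℕ) * N (∑ k, P k) := by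
  rcases min_choice m n with h | h <;> rw [h]
  exacts [hN.map_sum_conj_le_card_mul hP hW, hN.map_sum_conj_le_dim_mul hP hW hn]

/-- Expanding `0 ≤ (s W - 1) P (s W - 1)ᴴ`. -/
theorem _root_.Matrix.mul_add_conjTranspose_le {P : Matrix (Fin n) (Fin n) ℂ} (hP : 0 ≤ P)
    (W : Matrix (Fin n) (Fin n) ℂ) {s : ℝ} (hs : 0 < s) :
    W * P + (W * P)ᴴ ≤ (s : ℂ) • (W * P * star W) + (s⁻¹ : ℂ) • P := by
  have hPs : Pᴴ = P := (IsSelfAdjoint.of_nonneg hP).star_eq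
  have h := star_right_conjugate_nonneg hP ((s : ℂ) • W - 1)
  have hs' : (0 : ℂ) ≤ (s⁻¹ : ℂ) := by exact_mod_cast (inv_pos.2 hs).le
  have h2 : 0 ≤ (s⁻¹ : ℂ) • (((s : ℂ) • W - 1) * P * star ((s : ℂ) • W - 1)) :=
    Matrix.nonneg_iff_posSemidef.2 ((Matrix.nonneg_iff_posSemidef.1 h).smul hs')
  have hs0 : (s : ℂ) ≠ 0 := by exact_mod_cast hs.ne'
  rw [← sub_nonneg]
  refine h2.trans_eq ?_
  simp only [star_sub, star_smul, star_one, Matrix.star_eq_conjTranspose, sub_mul, mul_sub,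
    smul_mul_assoc, mul_smul_comm, one_mul, mul_one, Matrix.conjTranspose_mul, hPs, smul_sub,
    smul_smul, Complex.star_def, Complex.conj_ofReal, inv_mul_cancel₀ hs0, one_smul,
    inv_mul_cancel_left₀ hs0]
  abel

theorem map_sum_le (hN : IsUnitarilyInvariantNorm N) (hm : 1 ≤ m) (hn : 1 ≤ n)
    (A : Fin m → Matrix (Fin n) (Fin n) ℂ) :
    N (∑ k, A k) ≤ √((min m n : ℕ) : ℝ) * N (∑ k, matrixModulus (A k)) := by
  set S := ∑ k, matrixModulus (A k) with hS
  set c : ℝ := √((min m n : ℕ) : ℝ)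
  have hc : 0 < c := Real.sqrt_pos.2 (by exact_mod_cast lt_min hm hn)
  have hcc : c * c = ((min m n : ℕ) : ℝ) := Real.mul_self_sqrt (Nat.cast_nonneg _)
  choose U hU hUA using fun k => exists_unitary_mul_matrixModulus (A k)
  obtain ⟨V, hV, hVX⟩ := exists_unitary_mul_matrixModulus (∑ k, A k)
  set X := ∑ k, A k
  let W : Fin m → Matrix (Fin n) (Fin n) ℂ := fun k => star V * U k
  have hW : ∀ k, W k ∈ Matrix.unitaryGroup (Fin n) ℂ := fun k => mul_mem (Unitary.star_mem hV) (hU k)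
  have hMod : matrixModulus X = ∑ k, W k * matrixModulus (A k) := by
    have h1 : matrixModulus X = star V * X := by
      conv_rhs => rw [hVX, ← mul_assoc, Matrix.mem_unitaryGroup_iff'.1 hV, one_mul]
    rw [h1, Finset.mul_sum]
    refine Finset.sum_congr rfl fun k _ => ?_
    conv_lhs => rw [hUA k]
    rw [mul_assoc]
  set T := ∑ k, W k * matrixModulus (A k) * star (W k)
  have hT : N T ≤ c * c * N S := by
    rw [hcc]
    exact hN.map_sum_conj_le (fun k => matrixModulus_nonneg _) hW hn
  -- The weight `c⁻¹` balances the two terms: since `N T ≤ c² N S`, each contributes at most `c * N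
  -- S`.
  have hle : (2 : ℂ) • matrixModulus X ≤ ((c⁻¹ : ℝ) : ℂ) • T + (c : ℂ) • S := by
    have h : matrixModulus X + (matrixModulus X)ᴴ ≤ ((c⁻¹ : ℝ) : ℂ) • T + (c : ℂ) • S := by
      rw [hMod, Matrix.conjTranspose_sum, ← Finset.sum_add_distrib, Finset.smul_sum, hS,
        Finset.smul_sum, ← Finset.sum_add_distrib]
      refine Finset.sum_le_sum fun k _ => ?_
      simpa using Matrix.mul_add_conjTranspose_le (matrixModulus_nonneg (A k)) (W k) (inv_pos.2 hc)
    rwa [conjTranspose_matrixModulus, ← two_smul ℂ] at h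
  have h0 : 0 ≤ (2 : ℂ) • matrixModulus X := by
    rw [two_smul]
    exact add_nonneg (matrixModulus_nonneg X) (matrixModulus_nonneg X)
  have h := (hN.map_le_map_of_le h0 hle).trans (map_add_le_add N _ _)
  rw [map_smul_eq_mul, map_smul_eq_mul, map_smul_eq_mul, Complex.norm_of_nonneg hc.le,
    Complex.norm_of_nonneg (inv_pos.2 hc).le, Complex.norm_ofNat] at h
  have h3 : c⁻¹ * N T ≤ c * N S := by
    rw [inv_mul_le_iff₀ hc, ← mul_assoc]
    exact hT
  have h4 : N X = N (matrixModulus X) := by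
    conv_lhs => rw [hVX, hN.map_unitary_mul hV]
  linarith

end IsUnitarilyInvariantNorm

/-! ### Sharpness -/

section Sharpness

variable {n : ℕ}

theorem isUnitarilyInvariantNorm_normSeminorm :
    IsUnitarilyInvariantNorm (normSeminorm ℂ (Matrix (Fin n) (Fin n) ℂ)) where
  eq_zero_of_map_eq_zero _ h := norm_eq_zero.1 h
  map_unitary_mul_mul U hU V hV Z := by
    change ‖U * Z * V‖ = ‖Z‖
    rw [CStarRing.norm_mul_mem_unitary _ hV, CStarRing.norm_mem_unitary_mul _ hU]

theorem matrixModulus_single_one (i j : Fin n) :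
    matrixModulus (Matrix.single i j 1) = Matrix.single j j 1 := by
  rw [matrixModulus, Matrix.conjTranspose_single, star_one, Matrix.single_mul_single_same, mul_one]
  refine CFC.sqrt_unique (by simp) ?_
  rw [← Matrix.diagonal_single, Matrix.nonneg_iff_posSemidef, Matrix.posSemidef_diagonal_iff]
  intro k
  rcases eq_or_ne k j with rfl | h
  · simp
  · simp [h]

theorem matrixModulus_zero : matrixModulus (0 : Matrix (Fin n) (Fin n) ℂ) = 0 := by
  simp [matrixModulus]

/-- The matrix unit in the first row and the `k`-th column, or zero when there is no such column. -/
def firstRowUnit (hn : 1 ≤ n) (k : ℕ) : Matrix (Fin n) (Fin n) ℂ :=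
  if h : k < n then Matrix.single ⟨0, hn⟩ ⟨k, h⟩ 1 else 0

theorem sum_matrixModulus_firstRowUnit (m : ℕ) (hn : 1 ≤ n) :
    ∑ k : Fin m, matrixModulus (firstRowUnit hn k) =
      Matrix.diagonal fun i : Fin n => if (i : ℕ) < m then (1 : ℂ) else 0 := by
  have h : ∀ k : ℕ, matrixModulus (firstRowUnit hn k) =
      Matrix.diagonal fun i : Fin n => if (i : ℕ) = k then (1 : ℂ) else 0 := by
    intro k
    unfold firstRowUnit
    split_ifs with hk
    · rw [matrixModulus_single_one, ← Matrix.diagonal_single]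
      congr 1
      ext i
      simp [Pi.single_apply, Fin.ext_iff]
    · rw [matrixModulus_zero, eq_comm, Matrix.diagonal_eq_zero]
      ext i
      simp only [Pi.zero_apply, ite_eq_right_iff]
      omega
  induction m with
  | zero => simp
  | succ m ih =>
    rw [Fin.sum_univ_castSucc]
    simp only [Fin.val_castSucc, Fin.val_last]
    rw [ih, h, Matrix.diagonal_add]
    congr 1
    ext i
    split_ifs <;> first | omega | simp

theorem firstRowUnit_mul_conjTranspose (hn : 1 ≤ n) (k l : ℕ) :
    firstRowUnit hn k * (firstRowUnit hn l)ᴴ =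
      if k = l ∧ k < n then Matrix.single ⟨0, hn⟩ ⟨0, hn⟩ 1 else 0 := by
  unfold firstRowUnit
  by_cases hk : k < n <;> by_cases hl : l < n
  · by_cases hkl : k = l
    · subst hkl; simp [hk]
    · simp [hk, hl, hkl, Matrix.single_mul_single_of_ne]
  all_goals simp [hk, hl]
  intro h
  omega

theorem sum_firstRowUnit_mul_conjTranspose (m : ℕ) (hn : 1 ≤ n) :
    (∑ k : Fin m, firstRowUnit hn k) * (∑ k : Fin m, firstRowUnit hn k)ᴴ =
      Matrix.single ⟨0, hn⟩ ⟨0, hn⟩ ((min m n : ℕ) : ℂ) := by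
  have hcard : (Finset.univ.filter fun k : Fin m => (k : ℕ) < n).card = min m n := by
    rw [Fin.card_filter_val_lt]
  rw [Matrix.conjTranspose_sum, Finset.sum_mul_sum]
  have e : ∀ k : Fin m, ∑ l : Fin m, firstRowUnit hn k * (firstRowUnit hn l)ᴴ =
      if (k : ℕ) < n then Matrix.single ⟨0, hn⟩ ⟨0, hn⟩ 1 else 0 := by
    intro k
    rw [Finset.sum_eq_single k]
    · simp [firstRowUnit_mul_conjTranspose]
    · intro l _ hl
      rw [firstRowUnit_mul_conjTranspose, if_neg]
      exact fun h => hl (Fin.ext h.1.symm)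
    · simp
  rw [Finset.sum_congr rfl fun k _ => e k, ← Finset.sum_filter, Finset.sum_const, hcard,
    Matrix.smul_single, nsmul_eq_mul, mul_one]

theorem norm_sum_matrixModulus_firstRowUnit {m : ℕ} (hm : 1 ≤ m) (hn : 1 ≤ n) :
    ‖∑ k : Fin m, matrixModulus (firstRowUnit hn k)‖ = 1 := by
  rw [sum_matrixModulus_firstRowUnit, Matrix.l2_opNorm_diagonal]
  refine le_antisymm ((pi_norm_le_iff_of_nonneg zero_le_one).2 fun i => ?_) ?_
  · split_ifs <;> simp
  · refine le_of_eq_of_le ?_ (norm_le_pi_norm _ ⟨0, hn⟩)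
    simp [Nat.lt_of_lt_of_le Nat.zero_lt_one hm]

theorem norm_sum_firstRowUnit (m : ℕ) (hn : 1 ≤ n) :
    ‖∑ k : Fin m, firstRowUnit hn k‖ = √((min m n : ℕ) : ℝ) := by
  -- Applied to the adjoint, because for a row `B` the product `B Bᴴ` has a single nonzero entry.
  have h := Matrix.l2_opNorm_conjTranspose_mul_self (∑ k : Fin m, firstRowUnit hn k)ᴴ
  rw [Matrix.conjTranspose_conjTranspose, sum_firstRowUnit_mul_conjTranspose,
    ← Matrix.diagonal_single, Matrix.l2_opNorm_diagonal, Pi.norm_single,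
    Matrix.l2_opNorm_conjTranspose, Complex.norm_natCast] at h
  rw [h, Real.sqrt_mul_self (norm_nonneg _)]

end Sharpness

end UnitarilyInvariantNorms

theorem mainTheorem4 (m n : ℕ) (hm : 1 ≤ m) (hn : 1 ≤ n) :
    -- the inequality, for every unitarily invariant norm
    (∀ N : Seminorm ℂ (Matrix (Fin n) (Fin n) ℂ), IsUnitarilyInvariantNorm N →
      ∀ A : Fin m → Matrix (Fin n) (Fin n) ℂ,
        N (∑ k, A k) ≤ √((min m n : ℕ) : ℝ) * N (∑ k, matrixModulus (A k))) ∧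
    -- equality is attained, nontrivially, for the operator norm
    (∃ A : Fin m → Matrix (Fin n) (Fin n) ℂ,
      (∑ k, matrixModulus (A k)) ≠ 0 ∧
      matrixOperatorNorm (∑ k, A k) =
        √((min m n : ℕ) : ℝ) * matrixOperatorNorm (∑ k, matrixModulus (A k))) ∧
    -- no smaller constant is valid for all unitarily invariant norms
    (∀ c : ℝ,
      (∀ N : Seminorm ℂ (Matrix (Fin n) (Fin n) ℂ), IsUnitarilyInvariantNorm N →
        ∀ A : Fin m → Matrix (Fin n) (Fin n) ℂ,
          N (∑ k, A k) ≤ c * N (∑ k, matrixModulus (A k))) →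
      √((min m n : ℕ) : ℝ) ≤ c) := by
  have h1 : matrixOperatorNorm (∑ k : Fin m, firstRowUnit hn k) = √((min m n : ℕ) : ℝ) :=
    norm_sum_firstRowUnit m hn
  have h2 : matrixOperatorNorm (∑ k : Fin m, matrixModulus (firstRowUnit hn k)) = 1 :=
    norm_sum_matrixModulus_firstRowUnit hm hn
  refine ⟨fun N hN A => hN.map_sum_le hm hn A, ⟨fun k => firstRowUnit hn k, ?_, ?_⟩, fun c hc => ?_⟩
  · intro h
    simp [h, matrixOperatorNorm] at h2
  · rw [h1, h2, mul_one]
  · have h := hc _ isUnitarilyInvariantNorm_normSeminorm fun k : Fin m => firstRowUnit hn k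
    change matrixOperatorNorm (∑ k : Fin m, firstRowUnit hn k) ≤
      c * matrixOperatorNorm (∑ k : Fin m, matrixModulus (firstRowUnit hn k)) at h
    rwa [h1, h2, mul_one] at h
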